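/- Let $d,k\in\mathbb N$ and let $\Omega\subset\mathbb R^d$ be compact. Let $\mu$ be the measure on $\Omega$ with a bounded measurable density $u\ge 0$ with respect to Lebesgue measure, and let $D$ be the set of points of discontinuity of $u$ extended by $0$ outside $\Omega$. Say that a hyperplane $H$ *matches a discontinuity of $\mu$* if $\mathcal H^{d-1}(H\cap D)>0$, and assume that at most finitely many hyperplanes match a discontinuity of $\mu$. (This holds, for example, if $\Omega$ is a finite union of $d$-simplices and $u$ is piecewise linear on them.) Let $p_1,\dots,p_k\in\mathbb R^d$ be distinct points and $\nu_1,\dots,\nu_k\in\mathbb R$. For $W=(w_1,\dots,w_k)\in\mathbb R^k$ let $$\mathrm{Pow}_W(p_i)=\{x:\ \|x-p_i\|^2-w_i<\|x-p_j\|^2-w_j\ \ \forall j\ne i\},\qquad B_{ij}(W)=\{x:\ \|x-p_i\|^2-w_i=\|x-p_j\|^2-w_j\},$$ let $T_W$ be the assignment that sends $\mathrm{Pow}_W(p_i)$ to $p_i$, and put $$f_{T_W}(W)=\sum_{i=1}^k\int_{\mathrm{Pow}_W(p_i)\cap\Omega}\bigl(\|x-p_i\|^2-w_i\bigr)\,d\mu(x),\qquad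 g(W)=f_{T_W}(W)+\sum_{i=1}^k\nu_iw_i .$$ Then $W\mapsto f_{T_W}(W)$ and $g$ are of class $C^2$ almost everywhere: for Lebesgue-almost every $W\in\mathbb R^k$, both are $C^2$ in a neighbourhood of $W$. More precisely, both are $C^2$ in a neighbourhood of every $W$ such that no bisector $B_{ij}(W)$ with $i\neq j$ matches a discontinuity of $\mu$ and no two bisectors $B_{ij}(W)$, $B_{il}(W)$ with $i,j,l$ distinct coincide. Here $g$ is the concave function whose maximizers are the weights of the power diagrams adapted to the prescribed masses: $g$ is concave on $\mathbb R^k$, and $W$ is a global maximizer of $g$ if and only if $\mu(\mathrm{Pow}_W(p_i))=\nu_i$ for all $i$. -/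

import Mathlib

open MeasureTheory

namespace SemiDiscreteOT

noncomputable section

/-- Euclidean space of dimension `d`. -/
abbrev Pt (d : ℕ) : Type := EuclideanSpace ℝ (Fin d)

/-- The measure on `Ω` with density `u` with respect to the Lebesgue measure:
`μ B = ∫_{B ∩ Ω} u`. -/
def densityMeasure {d : ℕ} (Ω : Set (Pt d)) (u : Pt d → ℝ) : Measure (Pt d) :=
  (volume.restrict Ω).withDensity fun x => ENNReal.ofReal (u x)

/-- The power cell of `p i` for the weights `W`:
all `x` with `‖x - p i‖² - w i < ‖x - p j‖² - w j` for every `j ≠ i`. -/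
def powerCell {d k : ℕ} (p : Fin k → Pt d) (W : Fin k → ℝ) (i : Fin k) : Set (Pt d) :=
  {x | ∀ j, j ≠ i → ‖x - p i‖ ^ 2 - W i < ‖x - p j‖ ^ 2 - W j}

/-- The bisector (radical hyperplane) of the weighted points `p i` and `p j`. -/
def bisector {d k : ℕ} (p : Fin k → Pt d) (W : Fin k → ℝ) (i j : Fin k) : Set (Pt d) :=
  {x | ‖x - p i‖ ^ 2 - W i = ‖x - p j‖ ^ 2 - W j}

/-- The semi-discrete objective at the assignment of the power diagram, which sends `x` in the
power cell of `p i` to `p i`: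
`f W = ∑ i, ∫_{Pow_W(p i) ∩ Ω} (‖x - p i‖² - w i) dμ`. -/
def objective {d k : ℕ} (Ω : Set (Pt d)) (u : Pt d → ℝ) (p : Fin k → Pt d)
    (W : Fin k → ℝ) : ℝ :=
  ∑ i, ∫ x in powerCell p W i ∩ Ω, (‖x - p i‖ ^ 2 - W i) ∂(densityMeasure Ω u)

/-- The function `g W = f W + ∑ i, ν i * w i`. -/
def dualObjective {d k : ℕ} (Ω : Set (Pt d)) (u : Pt d → ℝ) (p : Fin k → Pt d)
    (ν : Fin k → ℝ) (W : Fin k → ℝ) : ℝ :=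
  objective Ω u p W + ∑ i, ν i * W i

/-- The discontinuities of the density of `densityMeasure Ω u` on the whole space, that is, of `u`
extended by zero outside `Ω`. -/
def discontinuitySet {d : ℕ} (Ω : Set (Pt d)) (u : Pt d → ℝ) : Set (Pt d) :=
  {x | ¬ ContinuousAt (Ω.indicator u) x}

/-- An affine hyperplane (a straight line if `d = 2`, a point if `d = 1`). -/
def IsHyperplane {d : ℕ} (H : Set (Pt d)) : Prop :=
  ∃ a : Pt d, a ≠ 0 ∧ ∃ b : ℝ, H = {x | inner ℝ a x = b}

/-- `H` matches the discontinuities of the density: it contains a part of them of positive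
`(d - 1)`-dimensional measure. -/
def MatchesDiscontinuity {d : ℕ} (Ω : Set (Pt d)) (u : Pt d → ℝ) (H : Set (Pt d)) : Prop :=
  Measure.hausdorffMeasure ((d : ℝ) - 1) (H ∩ discontinuitySet Ω u) ≠ 0

end

end SemiDiscreteOT

/-! Off the Lebesgue-null bisectors, the integrand of f_{T_W}(W) is the minimum over i of ‖x - p_i‖²
- w_i, times the density. Assigning points by the cells of another weight W' can therefore only
raise the cost, which gives g(W) ≤ g(W') + ∑ (ν_i - μ(Pow_{W'}(p_i))) (w_i - w'_i)
(`dualObjective_le`). So ν_i - μ(Pow_W(p_i)) are the components of a supergradient at every W, and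
they are continuous in W. Hence g is concave and differentiable everywhere with this gradient, and
its maximizers are the zeros of the gradient.

It remains to see that the cell masses are C^1 near a regular W (`contDiffAt_integral_polyhedron`).
A cell is a polyhedron with fixed normals and with offsets affine in W. By Fubini, the partial
derivative of its mass in one offset is a constant times the integral of the density over the
corresponding facet. By dominated convergence this facet integral is continuous once almost every
point of the facet's hyperplane is a continuity point of the density and lies on no other bounding
hyperplane. Regularity of W says exactly this. It is an open condition because only finitely many
hyperplanes match a discontinuity, and it holds almost everywhere because each way to fail confines
W to a null set. -/

namespace SemiDiscreteOT

open Set Filter Topology Function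

/-! ### Differentiability from continuous partial derivatives -/

/-- A function on `ι → ℝ` whose partial derivatives exist near a point and are continuous at that
point is strictly differentiable there. -/
theorem hasStrictFDerivAt_of_partialDerivs {ι : Type*} [Fintype ι] [DecidableEq ι]
    {f : (ι → ℝ) → ℝ} {g : ι → (ι → ℝ) → ℝ} {c : ι → ℝ}
    (hf : ∀ᶠ z in 𝓝 c, ∀ i, HasDerivAt (fun t => f (update z i t)) (g i z) (z i))
    (hg : ∀ i, ContinuousAt (g i) c) :
    HasStrictFDerivAt f
      (∑ i, g i c • (ContinuousLinearMap.proj i : (ι → ℝ) →L[ℝ] ℝ)) c := by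
  rw [hasStrictFDerivAt_iff_isLittleO, Asymptotics.isLittleO_iff]
  intro e he
  -- The `+ 1` in the witness keeps the denominator positive when `ι` is empty.
  obtain ⟨ε, hε, hεe⟩ : ∃ ε > 0, ε * (Fintype.card ι : ℝ) ≤ e := by
    refine ⟨e / (Fintype.card ι + 1), by positivity, ?_⟩
    rw [div_mul_eq_mul_div, div_le_iff₀ (by positivity)]
    nlinarith
  have h1 : ∀ᶠ z in 𝓝 c, ∀ i, HasDerivAt (fun t => f (update z i t)) (g i z) (z i) ∧
      ‖g i z - g i c‖ ≤ ε := by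
    have h2 : ∀ᶠ z in 𝓝 c, ∀ i, ‖g i z - g i c‖ ≤ ε := by
      rw [eventually_all]
      intro i
      have := (hg i).eventually (Metric.closedBall_mem_nhds (g i c) hε)
      filter_upwards [this] with z hz
      simpa [dist_eq_norm] using hz
    filter_upwards [hf, h2] with z a b i using ⟨a i, b i⟩
  obtain ⟨δ, hδ, hball⟩ := Metric.eventually_nhds_iff_ball.1 h1
  -- Pass from `y` to `x` one coordinate at a time, with the mean value inequality at each move.
  -- Balls of the sup norm are boxes, so the intermediate points stay in the ball.
  have key : ∀ x ∈ Metric.ball c δ, ∀ y ∈ Metric.ball c δ, ∀ s : Finset ι,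
      ‖f (s.piecewise x y) - f y - ∑ i ∈ s, g i c * (x i - y i)‖
        ≤ ε * ∑ i ∈ s, ‖x i - y i‖ := by
    intro x hx y hy s
    rw [Metric.mem_ball, dist_pi_lt_iff hδ] at hx hy
    induction s using Finset.induction_on with
    | empty => simp
    | insert i s his ih =>
      rw [Finset.sum_insert his, Finset.sum_insert his, Finset.piecewise_insert]
      set z := s.piecewise x y with hz
      have hzi : z i = y i := by simp [hz, his]
      have hzb : ∀ t ∈ uIcc (y i) (x i), update z i t ∈ Metric.ball c δ := by
        intro t ht
        rw [Metric.mem_ball, dist_pi_lt_iff hδ]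
        intro l
        by_cases hl : l = i
        · subst hl
          rw [update_self]
          have hc : Convex ℝ (Metric.ball (c l) δ) := convex_ball _ _
          rw [← segment_eq_uIcc] at ht
          exact hc.segment_subset (hy l) (hx l) ht
        · rw [update_of_ne hl, hz, Finset.piecewise]
          split_ifs
          exacts [hx l, hy l]
      have hd : ∀ t ∈ uIcc (y i) (x i), HasDerivWithinAt
          (fun t => f (update z i t) - g i c * t) (g i (update z i t) - g i c)
          (uIcc (y i) (x i)) t := by
        intro t ht
        have := ((hball _ (hzb t ht)) i).1
        simp only [update_idem, update_self] at this
        have h3 := this.sub ((hasDerivAt_id t).const_mul (g i c))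
        simp only [mul_one] at h3
        exact h3.hasDerivWithinAt
      have hmv := (convex_uIcc (y i) (x i)).norm_image_sub_le_of_norm_hasDerivWithin_le hd
        (fun t ht => ((hball _ (hzb t ht)) i).2) left_mem_uIcc right_mem_uIcc
      rw [← hzi, update_eq_self, hzi] at hmv
      calc _ = ‖(f (update z i (x i)) - g i c * x i - (f z - g i c * y i)) +
            (f z - f y - ∑ i ∈ s, g i c * (x i - y i))‖ := by congr 1; ring
        _ ≤ _ := norm_add_le _ _
        _ ≤ ε * ‖x i - y i‖ + ε * ∑ i ∈ s, ‖x i - y i‖ := add_le_add hmv ih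
        _ = _ := by ring
  have hmem : Metric.ball c δ ×ˢ Metric.ball c δ ∈ 𝓝 (c, c) :=
    prod_mem_nhds (Metric.ball_mem_nhds _ hδ) (Metric.ball_mem_nhds _ hδ)
  filter_upwards [hmem] with q hq
  have := key q.1 hq.1 q.2 hq.2 Finset.univ
  simp only [Finset.piecewise_univ] at this
  have h4 : (∑ i, g i c • (ContinuousLinearMap.proj i : (ι → ℝ) →L[ℝ] ℝ)) (q.1 - q.2) =
      ∑ i, g i c * (q.1 i - q.2 i) := by
    simp 
  rw [h4]
  refine this.trans ?_
  calc ε * ∑ i, ‖q.1 i - q.2 i‖ ≤ ε * ∑ _i : ι, ‖q.1 - q.2‖ := by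
        gcongr with i
        exact norm_le_pi_norm (q.1 - q.2) i
    _ = ε * Fintype.card ι * ‖q.1 - q.2‖ := by simp; ring
    _ ≤ e * ‖q.1 - q.2‖ := by gcongr

/-! ### Fubini along parallel hyperplanes -/

section Slices

variable {E : Type*} [NormedAddCommGroup E] [InnerProductSpace ℝ E]

/-- The hyperplane `a^⊥` through the origin. -/
noncomputable abbrev Perp (a : E) : Submodule ℝ E := (ℝ ∙ a)ᗮ

/-- The point of `{x | ⟪a, x⟫ = s}` with orthogonal projection `y` on `a^⊥`. -/
noncomputable def slicePoint (a : E) (s : ℝ) (y : Perp a) : E := (s / ‖a‖ ^ 2) • a + y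

theorem inner_perp (a : E) (y : Perp a) : inner ℝ a (y : E) = 0 :=
  Submodule.mem_orthogonal_singleton_iff_inner_right.1 y.2

theorem inner_slicePoint {a : E} (ha : a ≠ 0) (s : ℝ) (y : Perp a) :
    inner ℝ a (slicePoint a s y) = s := by
  have : ‖a‖ ≠ 0 := norm_ne_zero_iff.2 ha
  rw [slicePoint, inner_add_right, inner_perp, inner_smul_right, real_inner_self_eq_norm_sq]
  field_simp
  simp

theorem continuous_slicePoint (a : E) : Continuous fun q : ℝ × Perp a => slicePoint a q.1 q.2 := by
  unfold slicePoint
  fun_prop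

variable [FiniteDimensional ℝ E]

/-- Slicing the space by the hyperplanes orthogonal to `a`. -/
noncomputable def sliceEquiv (a : E) (ha : a ≠ 0) : (ℝ × Perp a) ≃L[ℝ] E :=
  LinearEquiv.toContinuousLinearEquiv
    { toFun := fun q => slicePoint a q.1 q.2
      invFun := fun x => (inner ℝ a x, ⟨x - (inner ℝ a x / ‖a‖ ^ 2) • a, by
        have : ‖a‖ ≠ 0 := norm_ne_zero_iff.2 ha
        rw [Submodule.mem_orthogonal_singleton_iff_inner_right, inner_sub_right,
          inner_smul_right, real_inner_self_eq_norm_sq]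
        field_simp
        simp⟩)
      map_add' := fun q r => by
        simp only [slicePoint, Prod.fst_add, Prod.snd_add, Submodule.coe_add, add_div, add_smul]
        abel
      map_smul' := fun t q => by
        simp [slicePoint, mul_div_assoc, mul_smul]
      left_inv := fun q => by
        ext
        · exact inner_slicePoint ha q.1 q.2
        · simp only [inner_slicePoint ha q.1 q.2]
          simp [slicePoint]
      right_inv := fun x => by
        simp [slicePoint] }

variable [MeasurableSpace E] [BorelSpace E]

/-- The Hausdorff measure of codimension one on `a^⊥`. -/
noncomputable abbrev perpMeasure (a : E) : Measure (Perp a) :=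
  Measure.hausdorffMeasure (Module.finrank ℝ (Perp a))

/-- The slicing map carries the product measure to a Haar measure, so uniqueness of Haar measure
supplies `κ`. Its value is never needed, only that it is the same for all `F`. -/
theorem exists_integral_eq_integral_slices {a : E} (ha : a ≠ 0) :
    ∃ κ : ℝ, ∀ F : E → ℝ, Integrable F →
      Integrable (fun s => ∫ y, F (slicePoint a s y) ∂perpMeasure a) ∧
      ∫ x, F x = κ * ∫ s, ∫ y, F (slicePoint a s y) ∂perpMeasure a := by
  set L := sliceEquiv a ha
  set m : Measure (ℝ × Perp a) := (volume : Measure ℝ).prod (perpMeasure a)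
  have : (m.map L).IsAddHaarMeasure := L.isAddHaarMeasure_map m
  have hκ := Measure.isAddLeftInvariant_eq_smul (volume : Measure E) (m.map L)
  set k := Measure.addHaarScalarFactor (volume : Measure E) (m.map L) with hk
  have hk0 : k ≠ 0 := by
    intro h
    rw [h, zero_smul] at hκ
    exact NeZero.ne (volume : Measure E) hκ
  have hL : MeasurableEmbedding L := L.toHomeomorph.measurableEmbedding
  refine ⟨k, fun F hF => ?_⟩
  rw [hκ] at hF ⊢
  have hF1 : Integrable F (m.map L) := by
    have := hF.smul_measure (c := ((k⁻¹ : NNReal) : ENNReal)) (by simp)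
    rwa [ENNReal.smul_def, smul_smul, ← ENNReal.coe_mul, inv_mul_cancel₀ hk0, ENNReal.coe_one,
      one_smul] at this
  have hF2 : Integrable (fun q => F (L q)) m := (hL.integrable_map_iff).1 hF1
  refine ⟨hF2.integral_prod_left, ?_⟩
  rw [integral_smul_nnreal_measure, hL.integral_map, integral_prod _ hF2]
  rfl

/-- Slicing turns the half-space integral into a one-variable integral up to `t`, and the
fundamental theorem of calculus applies wherever the slice integral is continuous. -/
theorem hasDerivAt_integral_halfSpace {a : E} (ha : a ≠ 0) : ∃ κ : ℝ, ∀ F : E → ℝ, Integrable F →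
    ∀ t, ContinuousAt (fun s => ∫ y, F (slicePoint a s y) ∂perpMeasure a) t →
      HasDerivAt (fun t => ∫ x in {x | inner ℝ a x < t}, F x)
        (κ * ∫ y, F (slicePoint a t y) ∂perpMeasure a) t := by
  obtain ⟨κ, hκ⟩ := exists_integral_eq_integral_slices ha
  refine ⟨κ, fun F hF t hc => ?_⟩
  set G := fun s => ∫ y, F (slicePoint a s y) ∂perpMeasure a with hG
  have hGi : Integrable G := (hκ F hF).1
  have hm : ∀ t, MeasurableSet {x : E | inner ℝ a x < t} := fun t =>
    (isOpen_lt (by fun_prop) continuous_const).measurableSet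
  have h1 : ∀ r, ∫ x in {x | inner ℝ a x < r}, F x = κ * ∫ s in Iic r, G s := by
    intro r
    rw [← integral_indicator (hm r), (hκ _ (hF.indicator (hm r))).2, integral_Iic_eq_integral_Iio,
      ← integral_indicator measurableSet_Iio]
    congr 2
    ext s
    by_cases hs : s < r
    · rw [indicator_of_mem (by exact hs), hG]
      refine integral_congr_ae (Eventually.of_forall fun y => ?_)
      simp [indicator, inner_slicePoint ha, hs]
    · rw [indicator_of_notMem (by exact hs)]
      refine integral_eq_zero_of_ae (Eventually.of_forall fun y => ?_)
      simp [indicator, inner_slicePoint ha, hs]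
  have h2 : ∀ r, ∫ x in {x | inner ℝ a x < r}, F x
      = κ * ((∫ s in (0 : ℝ)..r, G s) + ∫ s in Iic (0 : ℝ), G s) := by
    intro r
    rw [h1, ← intervalIntegral.integral_Iic_sub_Iic hGi.integrableOn hGi.integrableOn]
    ring
  simp only [h2]
  refine (HasDerivAt.add_const _ ?_).const_mul κ
  exact intervalIntegral.integral_hasDerivAt_right hGi.intervalIntegrable
    hGi.aestronglyMeasurable.stronglyMeasurableAtFilter hc

end Slices

/-! ### Null sets inside a hyperplane -/

section Slices

theorem addHaar_linearMap_eq {F : Type*} [NormedAddCommGroup F] [NormedSpace ℝ F]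
    [FiniteDimensional ℝ F] [MeasurableSpace F] [BorelSpace F] (μ : Measure F)
    [μ.IsAddHaarMeasure] {φ : F →ₗ[ℝ] ℝ} (hφ : φ ≠ 0) (r : ℝ) : μ {x | φ x = r} = 0 := by
  rcases ({x | φ x = r}).eq_empty_or_nonempty with h | ⟨x₀, hx₀⟩
  · rw [h, measure_empty]
  · have h1 : {x | φ x = r} = (fun x => x + -x₀) ⁻¹' (φ.ker : Set F) := by
      ext x
      have : φ x₀ = r := hx₀
      simp only [mem_ofPred_eq, mem_preimage, SetLike.mem_coe, LinearMap.mem_ker, map_add, map_neg,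
        this]
      constructor <;> intro h <;> linarith
    rw [h1, measure_preimage_add_right]
    exact Measure.addHaar_submodule μ _ fun h => hφ (LinearMap.ker_eq_top.1 h)

variable {E : Type*} [NormedAddCommGroup E] [InnerProductSpace ℝ E]

theorem norm_le_norm_slicePoint (a : E) (s : ℝ) (y : Perp a) : ‖y‖ ≤ ‖slicePoint a s y‖ := by
  have h : inner ℝ ((s / ‖a‖ ^ 2) • a) (y : E) = 0 := by
    rw [inner_smul_left, inner_perp, mul_zero]
  have := norm_add_sq_eq_norm_sq_add_norm_sq_real h
  rw [Submodule.norm_coe] at this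
  rw [slicePoint]
  nlinarith [norm_nonneg y, norm_nonneg ((s / ‖a‖ ^ 2) • a + (y : E)),
    norm_nonneg ((s / ‖a‖ ^ 2) • a)]

variable [FiniteDimensional ℝ E] [MeasurableSpace E] [BorelSpace E]

/-- If `b` is parallel to `a`, the left side is constant on the slice and equals `t` only when the
hyperplanes coincide. Otherwise `b` restricts to a nonzero functional on `a^⊥`, whose level sets are
null. -/
theorem ae_inner_slicePoint_ne {a b : E} (ha : a ≠ 0) (hb : b ≠ 0) {s t : ℝ}
    (hst : {x | inner ℝ a x = s} ≠ {x | inner ℝ b x = t}) :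
    ∀ᵐ y ∂perpMeasure a, inner ℝ b (slicePoint a s y) ≠ t := by
  set φ : Perp a →ₗ[ℝ] ℝ := (innerₛₗ ℝ b) ∘ₗ (Perp a).subtype with hφ
  have hval : ∀ y, inner ℝ b (slicePoint a s y) = s / ‖a‖ ^ 2 * inner ℝ b a + φ y := by
    intro y
    simp [slicePoint, inner_add_right, inner_smul_right, hφ]
  by_cases h0 : φ = 0
  · have hb' : b ∈ (Perp a)ᗮ := by
      rw [Submodule.mem_orthogonal]
      intro y hy
      rw [real_inner_comm]
      exact LinearMap.congr_fun h0 ⟨y, hy⟩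
    rw [Submodule.orthogonal_orthogonal, Submodule.mem_span_singleton] at hb'
    obtain ⟨r, rfl⟩ := hb'
    have hr : r ≠ 0 := by
      rintro rfl
      simp at hb
    refine Eventually.of_forall fun y hy => hst ?_
    rw [inner_smul_left, inner_slicePoint ha] at hy
    simp only [conj_trivial] at hy
    ext x
    simp only [mem_ofPred_eq, inner_smul_left, conj_trivial, ← hy]
    exact (mul_right_inj' hr).symm
  · have := addHaar_linearMap_eq (perpMeasure a) h0 (t - s / ‖a‖ ^ 2 * inner ℝ b a)
    rw [ae_iff]
    refine measure_mono_null (fun y hy => ?_) this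
    simp only [ne_eq, not_not, mem_ofPred_eq, hval] at hy ⊢
    linarith

/-- The parametrization of the slice is an isometry, so it transports Hausdorff measure. -/
theorem ae_slicePoint_notMem {a : E} (ha : a ≠ 0) {s : ℝ} {D : Set E}
    (h : Measure.hausdorffMeasure ((Module.finrank ℝ E : ℝ) - 1) ({x | inner ℝ a x = s} ∩ D) = 0) :
    ∀ᵐ y ∂perpMeasure a, slicePoint a s y ∉ D := by
  have hf : Isometry (slicePoint a s) := by
    refine Isometry.of_dist_eq fun y z => ?_
    simp [slicePoint, Subtype.dist_eq]
  have hr : ((Module.finrank ℝ (Perp a) : ℕ) : ℝ) = (Module.finrank ℝ E : ℝ) - 1 := by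
    have := (ℝ ∙ a).finrank_add_finrank_orthogonal
    rw [finrank_span_singleton ha] at this
    rw [← this]
    push_cast
    ring
  rw [ae_iff]
  simp only [not_not]
  change perpMeasure a (slicePoint a s ⁻¹' D) = 0
  rw [perpMeasure, hf.hausdorffMeasure_preimage (Or.inl (Nat.cast_nonneg _)), hr]
  refine measure_mono_null ?_ h
  rintro _ ⟨hx, y, rfl⟩
  exact ⟨inner_slicePoint ha s y, hx⟩

end Slices

/-! ### Integrals over polyhedra as functions of the offsets -/

section Polyhedra

variable {E ι : Type*} [NormedAddCommGroup E] [InnerProductSpace ℝ E]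

/-- The open polyhedron `{x | ∀ j, ⟪a j, x⟫ < c j}`. -/
def polyhedron (a : ι → E) (c : ι → ℝ) : Set E := {x | ∀ j, inner ℝ (a j) x < c j}

/-- The polyhedron obtained from `polyhedron a c` by dropping the constraint `j`. -/
def dropPolyhedron (a : ι → E) (c : ι → ℝ) (j : ι) : Set E :=
  {x | ∀ l, l ≠ j → inner ℝ (a l) x < c l}

theorem polyhedron_update [DecidableEq ι] (a : ι → E) (c : ι → ℝ) (j : ι) (t : ℝ) :
    polyhedron a (update c j t) = dropPolyhedron a c j ∩ {x | inner ℝ (a j) x < t} := by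
  ext x
  simp only [polyhedron, dropPolyhedron, mem_ofPred_eq, mem_inter_iff]
  constructor
  · intro h
    refine ⟨fun l hl => ?_, ?_⟩
    · simpa [hl] using h l
    · simpa using h j
  · rintro ⟨h1, h2⟩ l
    by_cases hl : l = j
    · subst hl
      simpa using h2
    · simpa [hl] using h1 l hl

theorem isOpen_polyhedron [Finite ι] (a : ι → E) (c : ι → ℝ) : IsOpen (polyhedron a c) := by
  simp only [polyhedron, ofPred_forall]
  exact isOpen_iInter_of_finite fun j => isOpen_lt (by fun_prop) continuous_const

theorem isOpen_dropPolyhedron [Finite ι] (a : ι → E) (c : ι → ℝ) (j : ι) :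
    IsOpen (dropPolyhedron a c j) := by
  simp only [dropPolyhedron, ofPred_forall]
  exact isOpen_iInter_of_finite fun l => isOpen_iInter_of_finite fun _ =>
    isOpen_lt (by fun_prop) continuous_const

/-- Both the point and the polyhedron move with `c`, but each constraint other than `j` is strictly
satisfied or strictly violated at the start, and strict inequalities persist. -/
theorem continuousAt_indicator_dropPolyhedron [Finite ι] {v : E → ℝ} {a : ι → E} {j : ι}
    {c : ι → ℝ} {y : Perp (a j)} (hv : ContinuousAt v (slicePoint (a j) (c j) y))
    (hne : ∀ l, l ≠ j → inner ℝ (a l) (slicePoint (a j) (c j) y) ≠ c l) :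
    ContinuousAt (fun c : ι → ℝ =>
      (dropPolyhedron a c j).indicator v (slicePoint (a j) (c j) y)) c := by
  have hs : Continuous fun c : ι → ℝ => slicePoint (a j) (c j) y :=
    (continuous_slicePoint (a j)).comp (by fun_prop : Continuous fun c : ι → ℝ => (c j, y))
  by_cases hz : slicePoint (a j) (c j) y ∈ dropPolyhedron a c j
  · have h1 : ∀ᶠ c' in 𝓝 c, slicePoint (a j) (c' j) y ∈ dropPolyhedron a c' j := by
      simp only [dropPolyhedron, mem_ofPred_eq, eventually_all]
      intro l hl
      exact (Continuous.continuousAt (by fun_prop)).eventually_lt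
        (continuous_apply l).continuousAt (hz l hl)
    have h2 : ContinuousAt (fun c' : ι → ℝ => v (slicePoint (a j) (c' j) y)) c :=
      ContinuousAt.comp (f := fun c' : ι → ℝ => slicePoint (a j) (c' j) y) hv hs.continuousAt
    refine h2.congr ?_
    filter_upwards [h1] with c' hc'
    rw [indicator_of_mem hc']
  · obtain ⟨l, hl, hlc⟩ : ∃ l, l ≠ j ∧ c l ≤ inner ℝ (a l) (slicePoint (a j) (c j) y) := by
      simpa [dropPolyhedron] using hz
    have h1 : ∀ᶠ c' in 𝓝 c, c' l < inner ℝ (a l) (slicePoint (a j) (c' j) y) :=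
      (continuous_apply l).continuousAt.eventually_lt (Continuous.continuousAt (by fun_prop))
        (lt_of_le_of_ne hlc (hne l hl).symm)
    refine (continuousAt_const (y := (0 : ℝ))).congr ?_
    filter_upwards [h1] with c' hc'
    rw [indicator_of_notMem]
    exact fun h => (h l hl).not_gt hc'

variable [FiniteDimensional ℝ E] [MeasurableSpace E] [BorelSpace E]

/-- The integral of `v` over the part of the hyperplane `⟪a j, x⟫ = c j` that satisfies the other
constraints of `polyhedron a c`. -/
noncomputable def facetIntegral (v : E → ℝ) (a : ι → E) (j : ι) (c : ι → ℝ) : ℝ :=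
  ∫ y, (dropPolyhedron a c j).indicator v (slicePoint (a j) (c j) y) ∂perpMeasure (a j)

/-- The bounding hyperplanes of `polyhedron a c` are pairwise distinct and none of them matches
the discontinuities of `v`. -/
def IsRegularOffset (v : E → ℝ) (a : ι → E) (c : ι → ℝ) : Prop :=
  (∀ j, Measure.hausdorffMeasure ((Module.finrank ℝ E : ℝ) - 1)
    ({x | inner ℝ (a j) x = c j} ∩ {x | ¬ ContinuousAt v x}) = 0) ∧
  ∀ j l, l ≠ j → {x | inner ℝ (a j) x = c j} ≠ {x | inner ℝ (a l) x = c l}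

theorem continuousAt_facetIntegral [Finite ι] {v : E → ℝ} (hv : Measurable v) {C R : ℝ}
    (hC : ∀ x, ‖v x‖ ≤ C) (hR : ∀ x, R < ‖x‖ → v x = 0) {a : ι → E} (ha : ∀ j, a j ≠ 0)
    {c : ι → ℝ} (hc : IsRegularOffset v a c) (j : ι) : ContinuousAt (facetIntegral v a j) c := by
  have hC0 : 0 ≤ C := (norm_nonneg _).trans (hC 0)
  -- Projection to `a^⊥` does not increase norms, so one ball of `a^⊥` contains the support of the
  -- integrand for all offsets.
  refine continuousAt_of_dominated (bound := (Metric.closedBall 0 R).indicator fun _ => C)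
    (Eventually.of_forall fun c' => ?_) (Eventually.of_forall fun c' =>
      Eventually.of_forall fun y => ?_) ?_ ?_
  · have h1 : Measurable (slicePoint (a j) (c' j)) := by
      have : Continuous (slicePoint (a j) (c' j)) := by
        unfold slicePoint
        fun_prop
      exact this.measurable
    exact ((hv.indicator (isOpen_dropPolyhedron a c' j).measurableSet).comp h1).aestronglyMeasurable
  · refine (norm_indicator_le_norm_self v _).trans ?_
    by_cases hy : y ∈ Metric.closedBall (0 : Perp (a j)) R
    · rw [indicator_of_mem hy]
      exact hC _
    · rw [indicator_of_notMem hy, hR, norm_zero]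
      rw [mem_closedBall_zero_iff, not_le] at hy
      exact hy.trans_le (norm_le_norm_slicePoint _ _ _)
  · rw [integrable_indicator_iff Metric.isClosed_closedBall.measurableSet]
    exact integrableOn_const (isCompact_closedBall _ _).measure_lt_top.ne
  · have h1 := ae_slicePoint_notMem (ha j) (hc.1 j)
    have h2 : ∀ᵐ y ∂perpMeasure (a j), ∀ l, l ≠ j →
        inner ℝ (a l) (slicePoint (a j) (c j) y) ≠ c l := by
      rw [ae_all_iff]
      intro l
      by_cases hl : l = j
      · exact Eventually.of_forall fun y h => absurd hl h
      · filter_upwards [ae_inner_slicePoint_ne (ha j) (ha l) (hc.2 j l hl)] with y hy _ using hy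
    filter_upwards [h1, h2] with y hy1 hy2
    exact continuousAt_indicator_dropPolyhedron (by simpa using hy1) hy2

theorem integrable_of_bounded_support {v : E → ℝ} (hv : Measurable v) {C R : ℝ}
    (hC : ∀ x, ‖v x‖ ≤ C) (hR : ∀ x, R < ‖x‖ → v x = 0) : Integrable v := by
  have h1 : Integrable ((Metric.closedBall (0 : E) R).indicator fun _ => C) := by
    rw [integrable_indicator_iff Metric.isClosed_closedBall.measurableSet]
    exact integrableOn_const (isCompact_closedBall _ _).measure_lt_top.ne
  refine h1.mono' hv.aestronglyMeasurable (Eventually.of_forall fun x => ?_)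
  by_cases hx : x ∈ Metric.closedBall (0 : E) R
  · rw [indicator_of_mem hx]
    exact hC _
  · rw [indicator_of_notMem hx, hR, norm_zero]
    rwa [mem_closedBall_zero_iff, not_le] at hx

theorem contDiffAt_integral_polyhedron [Fintype ι] {v : E → ℝ} (hv : Measurable v) {C R : ℝ}
    (hC : ∀ x, ‖v x‖ ≤ C) (hR : ∀ x, R < ‖x‖ → v x = 0) {a : ι → E} (ha : ∀ j, a j ≠ 0)
    {c : ι → ℝ} (hc : ∀ᶠ c' in 𝓝 c, IsRegularOffset v a c') :
    ContDiffAt ℝ 1 (fun c => ∫ x in polyhedron a c, v x) c := by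
  classical
  choose κ hκ using fun j => hasDerivAt_integral_halfSpace (ha j)
  have hcont : ∀ c', IsRegularOffset v a c' → ∀ j,
      ContinuousAt (fun c => κ j * facetIntegral v a j c) c' := fun c' h j =>
    continuousAt_const.mul (continuousAt_facetIntegral hv hC hR ha h j)
  have hpart : ∀ c', IsRegularOffset v a c' → ∀ j,
      HasDerivAt (fun t => ∫ x in polyhedron a (update c' j t), v x)
        (κ j * facetIntegral v a j c') (c' j) := by
    intro c' h j
    have hm := (isOpen_dropPolyhedron a c' j).measurableSet
    -- Moving the offset `j` leaves the other constraints fixed, so the integral is a half-space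
    -- integral of one fixed truncated density.
    have hd : ∀ t, dropPolyhedron a (update c' j t) j = dropPolyhedron a c' j := by
      intro t
      ext x
      refine forall_congr' fun l => forall_congr' fun hl => ?_
      rw [update_of_ne hl]
    have h1 := hκ j ((dropPolyhedron a c' j).indicator v)
      ((integrable_of_bounded_support hv hC hR).indicator hm) (c' j) (by
        have h2 := continuousAt_facetIntegral hv hC hR ha h j
        have h3 : ContinuousAt (fun t => update c' j t) (c' j) :=
          (continuous_const.update j continuous_id).continuousAt
        have h4 := ContinuousAt.comp (f := fun t => update c' j t) (x := c' j)
          (g := facetIntegral v a j) (by rwa [update_eq_self]) h3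
        refine h4.congr (Eventually.of_forall fun t => ?_)
        simp only [comp_apply, facetIntegral, hd, update_self])
    have h5 : (fun t => ∫ x in polyhedron a (update c' j t), v x) =
        fun t => ∫ x in {x | inner ℝ (a j) x < t}, (dropPolyhedron a c' j).indicator v x := by
      ext t
      rw [setIntegral_indicator hm, polyhedron_update, inter_comm]
    rw [h5]
    exact h1
  rw [show (1 : WithTop ℕ∞) = ((0 : ℕ) : WithTop ℕ∞) + 1 by simp, contDiffAt_succ_iff_hasFDerivAt]
  refine ⟨fun c' => ∑ j, (κ j * facetIntegral v a j c') •
    (ContinuousLinearMap.proj j : (ι → ℝ) →L[ℝ] ℝ), ⟨_, hc.eventually_nhds, ?_⟩, ?_⟩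
  · intro c' hc'
    exact (hasStrictFDerivAt_of_partialDerivs (hc'.mono fun z hz => hpart z hz)
      (hcont c' hc'.self_of_nhds)).hasFDerivAt
  · rw [Nat.cast_zero, contDiffAt_zero]
    refine ⟨_, hc, continuousOn_of_forall_continuousAt fun c' hc' => ?_⟩
    exact tendsto_finsetSum _ fun j _ => (hcont c' hc' j).smul continuousAt_const

end Polyhedra

/-! ### Functions with a continuous supergradient -/

section Supergradient

variable {ι : Type*} [Fintype ι] {f : (ι → ℝ) → ℝ} {m : ι → (ι → ℝ) → ℝ}

theorem concaveOn_of_supergradient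
    (h : ∀ W W', f W ≤ f W' + ∑ i, m i W' * (W i - W' i)) : ConcaveOn ℝ univ f := by
  refine ⟨convex_univ, fun x _ y _ a b ha hb hab => ?_⟩
  set z := a • x + b • y with hz
  have h1 := mul_le_mul_of_nonneg_left (h x z) ha
  have h2 := mul_le_mul_of_nonneg_left (h y z) hb
  -- The linear terms cancel because `z` is the weighted mean of `x` and `y`.
  have h3 : a * ∑ i, m i z * (x i - z i) + b * ∑ i, m i z * (y i - z i) = 0 := by
    rw [Finset.mul_sum, Finset.mul_sum, ← Finset.sum_add_distrib]
    refine Finset.sum_eq_zero fun i _ => ?_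
    have hzi : z i = a * x i + b * y i := by simp [hz]
    have : b = 1 - a := by linarith
    rw [hzi, this]
    ring
  have h4 : a * f z + b * f z = f z := by rw [← add_mul, hab, one_mul]
  simp only [smul_eq_mul]
  linarith

/-- Using the inequality in both directions traps `f W - f W₀` between the linear forms with
coefficients `m i W` and `m i W₀`, which differ by o(1) ‖W - W₀‖. -/
theorem hasFDerivAt_of_supergradient
    (h : ∀ W W', f W ≤ f W' + ∑ i, m i W' * (W i - W' i)) {W₀ : ι → ℝ}
    (hm : ∀ i, ContinuousAt (m i) W₀) :
    HasFDerivAt f (∑ i, m i W₀ • (ContinuousLinearMap.proj i : (ι → ℝ) →L[ℝ] ℝ)) W₀ := by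
  have hη : Tendsto (fun W => ∑ i, ‖m i W - m i W₀‖) (𝓝 W₀) (𝓝 0) := by
    rw [← Finset.sum_const_zero (s := (Finset.univ : Finset ι))]
    refine tendsto_finsetSum _ fun i _ => ?_
    have := ((hm i).sub_const (m i W₀)).norm
    simpa [ContinuousAt] using this
  rw [hasFDerivAt_iff_isLittleO, Asymptotics.isLittleO_iff]
  intro e he
  filter_upwards [hη.eventually_le_const he] with W hW
  have hL : (∑ i, m i W₀ • (ContinuousLinearMap.proj i : (ι → ℝ) →L[ℝ] ℝ)) (W - W₀) =
      ∑ i, m i W₀ * (W i - W₀ i) := by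
    simp
  rw [hL]
  have h1 := h W W₀
  have h2 := h W₀ W
  have h3 : ∑ i, m i W * (W₀ i - W i) + ∑ i, m i W₀ * (W i - W₀ i) ≤
      ∑ i, ‖m i W - m i W₀‖ * ‖W - W₀‖ := by
    rw [← Finset.sum_add_distrib]
    refine Finset.sum_le_sum fun i _ => ?_
    calc _ = -((m i W - m i W₀) * (W - W₀) i) := by simp only [Pi.sub_apply]; ring
      _ ≤ ‖(m i W - m i W₀) * (W - W₀) i‖ := by
        rw [Real.norm_eq_abs]
        exact neg_le_abs _
      _ ≤ _ := by
        rw [norm_mul]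
        gcongr
        exact norm_le_pi_norm (W - W₀) i
  rw [← Finset.sum_mul] at h3
  have h4 := h3.trans (mul_le_mul_of_nonneg_right hW (norm_nonneg (W - W₀)))
  have h5 : 0 ≤ e * ‖W - W₀‖ := by positivity
  rw [Real.norm_eq_abs, abs_le]
  constructor <;> linarith

theorem isMaxOn_iff_of_supergradient
    (h : ∀ W W', f W ≤ f W' + ∑ i, m i W' * (W i - W' i)) {W₀ : ι → ℝ}
    (hm : ∀ i, ContinuousAt (m i) W₀) : IsMaxOn f univ W₀ ↔ ∀ i, m i W₀ = 0 := by
  classical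
  constructor
  · intro hmax i
    have h1 := (hmax.isLocalMax univ_mem).hasFDerivAt_eq_zero (hasFDerivAt_of_supergradient h hm)
    have h2 := DFunLike.congr_fun h1 (Pi.single i 1)
    simpa [Pi.single_apply] using h2
  · intro h0 W _
    simpa [h0] using h W W₀

end Supergradient

/-! ### When two hyperplanes coincide -/

section Hyperplanes

variable {E : Type*} [NormedAddCommGroup E] [InnerProductSpace ℝ E]

/-- Bisector normals do not depend on `W`, so this reduces coincidence of bisectors to one affine
equation in `W`. -/
theorem hyperplane_eq_iff {a b : E} (ha : a ≠ 0) (hb : b ≠ 0) {s t : ℝ} :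
    {x | inner ℝ a x = s} = {x | inner ℝ b x = t} ↔ ∃ r : ℝ, b = r • a ∧ t = r * s := by
  constructor
  · intro h
    have h0 : ∀ y : Perp a, inner ℝ b (slicePoint a s y) = t := fun y => by
      have : slicePoint a s y ∈ {x | inner ℝ a x = s} := inner_slicePoint ha s y
      rwa [h] at this
    have hb' : b ∈ (Perp a)ᗮ := by
      rw [Submodule.mem_orthogonal]
      intro y hy
      have h1 := h0 ⟨y, hy⟩
      have h2 := h0 0
      simp only [slicePoint, inner_add_right, Submodule.coe_zero, inner_zero_right] at h1 h2
      rw [real_inner_comm]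
      linarith
    rw [Submodule.orthogonal_orthogonal, Submodule.mem_span_singleton] at hb'
    obtain ⟨r, rfl⟩ := hb'
    refine ⟨r, rfl, ?_⟩
    have := h0 0
    rw [inner_smul_left, inner_slicePoint ha] at this
    simpa using this.symm
  · rintro ⟨r, rfl, rfl⟩
    have hr : r ≠ 0 := by
      rintro rfl
      simp at hb
    ext x
    simp only [mem_ofPred_eq, inner_smul_left, conj_trivial]
    exact (mul_right_inj' hr).symm

theorem hyperplane_injective {a : E} (ha : a ≠ 0) :
    Injective fun t : ℝ => {x | inner ℝ a x = t} := by
  intro s t h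
  obtain ⟨r, hr, rfl⟩ := (hyperplane_eq_iff ha ha).1 h
  have : (1 - r) • a = 0 := by rw [sub_smul, one_smul, ← hr, sub_self]
  rw [smul_eq_zero, or_iff_left ha] at this
  have : r = 1 := by linarith
  simp [this]

end Hyperplanes

/-! ### Power cells and the supergradient inequality -/

section PowerDiagram

variable {d k : ℕ}

/-- The normal vector of the bisectors of `p i` and `p j`. -/
noncomputable def bisectorNormal (p : Fin k → Pt d) (i j : Fin k) : Pt d := (2 : ℝ) • (p j - p i)

/-- The offset of the bisector of `p i` and `p j` for the weights `W`. -/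
noncomputable def bisectorOffset (p : Fin k → Pt d) (W : Fin k → ℝ) (i j : Fin k) : ℝ :=
  ‖p j‖ ^ 2 - ‖p i‖ ^ 2 + (W i - W j)

theorem bisectorNormal_ne_zero {p : Fin k → Pt d} (hp : Injective p) {i j : Fin k} (h : i ≠ j) :
    bisectorNormal p i j ≠ 0 :=
  smul_ne_zero two_ne_zero (sub_ne_zero.2 fun e => h (hp e).symm)

theorem power_sub_power (p : Fin k → Pt d) (W : Fin k → ℝ) (i j : Fin k) (x : Pt d) :
    (‖x - p j‖ ^ 2 - W j) - (‖x - p i‖ ^ 2 - W i) =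
      bisectorOffset p W i j - inner ℝ (bisectorNormal p i j) x := by
  rw [norm_sub_sq_real, norm_sub_sq_real, bisectorOffset, bisectorNormal, inner_smul_left,
    inner_sub_left, real_inner_comm x (p i), real_inner_comm x (p j)]
  simp only [conj_trivial]
  ring

theorem bisector_eq (p : Fin k → Pt d) (W : Fin k → ℝ) (i j : Fin k) :
    bisector p W i j = {x | inner ℝ (bisectorNormal p i j) x = bisectorOffset p W i j} := by
  ext x
  have := power_sub_power p W i j x
  simp only [bisector, mem_ofPred_eq]
  constructor <;> intro h <;> linarith

theorem powerCell_eq (p : Fin k → Pt d) (W : Fin k → ℝ) (i : Fin k) :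
    powerCell p W i = polyhedron (fun j : {j // j ≠ i} => bisectorNormal p i j)
      (fun j => bisectorOffset p W i j) := by
  ext x
  simp only [powerCell, polyhedron, mem_ofPred_eq, Subtype.forall]
  refine forall_congr' fun j => forall_congr' fun _ => ?_
  have := power_sub_power p W i j x
  constructor <;> intro h <;> linarith

theorem measurableSet_powerCell (p : Fin k → Pt d) (W : Fin k → ℝ) (i : Fin k) :
    MeasurableSet (powerCell p W i) := by
  rw [powerCell_eq]
  exact (isOpen_polyhedron _ _).measurableSet

theorem powerCell_unique {p : Fin k → Pt d} {W : Fin k → ℝ} {i j : Fin k} {x : Pt d}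
    (hi : x ∈ powerCell p W i) (hj : x ∈ powerCell p W j) : i = j := by
  by_contra h
  exact lt_asymm (hi j (Ne.symm h)) (hj i h)

theorem continuous_bisectorOffset (p : Fin k → Pt d) (i j : Fin k) :
    Continuous fun W => bisectorOffset p W i j := by
  unfold bisectorOffset
  fun_prop

theorem volume_bisector {p : Fin k → Pt d} (hp : Injective p) (W : Fin k → ℝ) {i j : Fin k}
    (h : i ≠ j) : volume (bisector p W i j) = 0 := by
  rw [bisector_eq]
  refine addHaar_linearMap_eq volume (φ := innerₛₗ ℝ (bisectorNormal p i j)) (fun h0 => ?_) _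
  have := LinearMap.congr_fun h0 (bisectorNormal p i j)
  simp only [innerₛₗ_apply_apply, LinearMap.zero_apply, inner_self_eq_zero] at this
  exact bisectorNormal_ne_zero hp h this

theorem ae_notMem_bisector {p : Fin k → Pt d} (hp : Injective p) (W : Fin k → ℝ) :
    ∀ᵐ x : Pt d, ∀ i j, i ≠ j → x ∉ bisector p W i j := by
  rw [ae_all_iff]
  intro i
  rw [ae_all_iff]
  intro j
  by_cases h : i = j
  · exact Eventually.of_forall fun x h' => absurd h h'
  · filter_upwards [measure_eq_zero_iff_ae_notMem.1 (volume_bisector hp W h)] with x hx _ using hx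

theorem exists_mem_powerCell [Nonempty (Fin k)] {p : Fin k → Pt d} {W : Fin k → ℝ} {x : Pt d}
    (hx : ∀ i j, i ≠ j → x ∉ bisector p W i j) : ∃ i, x ∈ powerCell p W i := by
  obtain ⟨i, hi⟩ := Finite.exists_min fun i => ‖x - p i‖ ^ 2 - W i
  exact ⟨i, fun j hj => lt_of_le_of_ne (hi j) (hx i j hj.symm)⟩

theorem integrable_mul_continuous {Ω : Set (Pt d)} (hΩ : IsCompact Ω) {v h : Pt d → ℝ}
    (hv : Integrable v) (hvΩ : ∀ x ∉ Ω, v x = 0) (hh : Continuous h) :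
    Integrable fun x => v x * h x := by
  obtain ⟨K, hK⟩ := hΩ.exists_bound_of_continuousOn hh.continuousOn
  refine (hv.norm.mul_const K).mono' (hv.aestronglyMeasurable.mul hh.aestronglyMeasurable)
    (Eventually.of_forall fun x => ?_)
  rw [norm_mul]
  by_cases hx : x ∈ Ω
  · gcongr
    exact hK x hx
  · simp [hvΩ x hx]

theorem sum_indicator_powerCell_le {p : Fin k → Pt d} {v : Pt d → ℝ} (hv0 : ∀ x, 0 ≤ v x)
    {W W' : Fin k → ℝ} {x : Pt d} (hx : ∀ i j, i ≠ j → x ∉ bisector p W i j)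
    (hx' : ∀ i j, i ≠ j → x ∉ bisector p W' i j) :
    ∑ i, (powerCell p W i).indicator (fun x => v x * (‖x - p i‖ ^ 2 - W i)) x ≤
      ∑ i, (powerCell p W' i).indicator (fun x => v x * (‖x - p i‖ ^ 2 - W i)) x := by
  rcases isEmpty_or_nonempty (Fin k) with h | h
  · simp
  obtain ⟨i, hi⟩ := exists_mem_powerCell hx
  obtain ⟨j, hj⟩ := exists_mem_powerCell hx'
  rw [Finset.sum_eq_single i, Finset.sum_eq_single j, indicator_of_mem hi, indicator_of_mem hj]
  · refine mul_le_mul_of_nonneg_left ?_ (hv0 x)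
    by_cases hij : j = i
    · rw [hij]
    · exact (hi j hij).le
  · exact fun l _ hl => indicator_of_notMem (fun h => hl (powerCell_unique h hj)) _
  · simp
  · exact fun l _ hl => indicator_of_notMem (fun h => hl (powerCell_unique h hi)) _
  · simp

theorem sum_integral_powerCell_le {Ω : Set (Pt d)} (hΩ : IsCompact Ω) {p : Fin k → Pt d}
    (hp : Injective p) {v : Pt d → ℝ} (hv : Integrable v) (hvΩ : ∀ x ∉ Ω, v x = 0)
    (hv0 : ∀ x, 0 ≤ v x) (W W' : Fin k → ℝ) :
    ∑ i, ∫ x in powerCell p W i, v x * (‖x - p i‖ ^ 2 - W i) ≤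
      (∑ i, ∫ x in powerCell p W' i, v x * (‖x - p i‖ ^ 2 - W' i)) +
        ∑ i, -(∫ x in powerCell p W' i, v x) * (W i - W' i) := by
  have hint : ∀ V V' : Fin k → ℝ, ∀ i, Integrable
      ((powerCell p V i).indicator fun x => v x * (‖x - p i‖ ^ 2 - V' i)) := fun V V' i =>
    (integrable_mul_continuous hΩ hv hvΩ (by fun_prop)).indicator (measurableSet_powerCell p V i)
  -- Changing the weights in the integrand but not the cells shifts each cost by a constant, which
  -- produces the linear term.
  have h1 : ∀ i, ∫ x in powerCell p W' i, v x * (‖x - p i‖ ^ 2 - W i) =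
      (∫ x in powerCell p W' i, v x * (‖x - p i‖ ^ 2 - W' i)) +
        -(∫ x in powerCell p W' i, v x) * (W i - W' i) := by
    intro i
    rw [neg_mul, ← integral_mul_const, ← sub_eq_add_neg, ← integral_sub
      (integrable_mul_continuous hΩ hv hvΩ (by fun_prop)).integrableOn
      (hv.mul_const _).integrableOn]
    congr 1
    ext x
    ring
  rw [← Finset.sum_add_distrib, ← Finset.sum_congr rfl fun i _ => h1 i]
  simp only [← integral_indicator (measurableSet_powerCell p _ _)]
  rw [← integral_finsetSum _ fun i _ => hint W W i, ← integral_finsetSum _ fun i _ => hint W' W i]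
  refine integral_mono_ae (integrable_finsetSum _ fun i _ => hint W W i)
    (integrable_finsetSum _ fun i _ => hint W' W i) ?_
  filter_upwards [ae_notMem_bisector hp W, ae_notMem_bisector hp W'] with x hx hx'
  exact sum_indicator_powerCell_le hv0 hx hx'

/-- For `x` off the bisectors of `W`, membership in the cell is locally constant in the weights, and
`‖v‖` dominates. -/
theorem continuous_integral_powerCell {p : Fin k → Pt d} (hp : Injective p) {v : Pt d → ℝ}
    (hv : Integrable v) (i : Fin k) : Continuous fun W => ∫ x in powerCell p W i, v x := by
  rw [continuous_iff_continuousAt]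
  intro W
  simp only [← integral_indicator (measurableSet_powerCell p _ _)]
  refine continuousAt_of_dominated (bound := fun x => ‖v x‖)
    (Eventually.of_forall fun W' =>
      (hv.indicator (measurableSet_powerCell p W' i)).aestronglyMeasurable)
    (Eventually.of_forall fun W' => Eventually.of_forall fun x => norm_indicator_le_norm_self v x)
    hv.norm ?_
  filter_upwards [ae_notMem_bisector hp W] with x hx
  have hcost : ∀ j, Continuous fun V : Fin k → ℝ => ‖x - p j‖ ^ 2 - V j := fun j => by fun_prop
  by_cases hxi : x ∈ powerCell p W i
  · have h1 : ∀ᶠ W' in 𝓝 W, x ∈ powerCell p W' i := by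
      simp only [powerCell, mem_ofPred_eq, eventually_all]
      exact fun j hj =>
        (hcost i).continuousAt.eventually_lt (hcost j).continuousAt (hxi j hj)
    refine (continuousAt_const (y := v x)).congr ?_
    filter_upwards [h1] with W' hW'
    rw [indicator_of_mem hW']
  · obtain ⟨j, hj, hle⟩ : ∃ j, j ≠ i ∧ ‖x - p j‖ ^ 2 - W j ≤ ‖x - p i‖ ^ 2 - W i := by
      simpa only [powerCell, mem_ofPred_eq, not_forall, not_lt, exists_prop] using hxi
    have h1 := (hcost j).continuousAt.eventually_lt (hcost i).continuousAt
      (lt_of_le_of_ne hle (hx j i hj))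
    refine (continuousAt_const (y := (0 : ℝ))).congr ?_
    filter_upwards [h1] with W' hW'
    rw [indicator_of_notMem]
    exact fun h => (h j hj).not_gt hW'

theorem setIntegral_densityMeasure {Ω : Set (Pt d)} (hΩ : MeasurableSet Ω) {u : Pt d → ℝ}
    (hu : Measurable u) (hu0 : ∀ x ∈ Ω, 0 ≤ u x) {S : Set (Pt d)} (hS : MeasurableSet S)
    (h : Pt d → ℝ) :
    ∫ x in S ∩ Ω, h x ∂densityMeasure Ω u = ∫ x in S, Ω.indicator u x * h x := by
  rw [densityMeasure, setIntegral_withDensity_eq_setIntegral_toReal_smul hu.ennreal_ofReal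
    (Eventually.of_forall fun _ => ENNReal.ofReal_lt_top) _ (hS.inter hΩ),
    Measure.restrict_restrict (hS.inter hΩ), inter_assoc, inter_self]
  have h1 : (fun x => Ω.indicator u x * h x) = Ω.indicator fun x => u x * h x := by
    ext x
    by_cases hx : x ∈ Ω <;> simp [hx]
  rw [h1, setIntegral_indicator hΩ]
  refine setIntegral_congr_fun (hS.inter hΩ) fun x hx => ?_
  simp only [smul_eq_mul]
  rw [ENNReal.toReal_ofReal (hu0 x hx.2)]

theorem densityMeasure_real {Ω : Set (Pt d)} (hΩ : MeasurableSet Ω) {u : Pt d → ℝ}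
    (hu : Measurable u) (hu0 : ∀ x ∈ Ω, 0 ≤ u x) {S : Set (Pt d)} (hS : MeasurableSet S) :
    (densityMeasure Ω u).real S = ∫ x in S, Ω.indicator u x := by
  have h1 : densityMeasure Ω u S = densityMeasure Ω u (S ∩ Ω) := by
    rw [densityMeasure, withDensity_apply _ hS, withDensity_apply _ (hS.inter hΩ),
      Measure.restrict_restrict hS, Measure.restrict_restrict (hS.inter hΩ), inter_assoc,
      inter_self]
  have h2 := setIntegral_densityMeasure hΩ hu hu0 hS fun _ => 1
  simp only [mul_one] at h2
  rw [← h2, setIntegral_const, smul_eq_mul, mul_one, measureReal_def, measureReal_def, h1]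

/-! ### Regular weights: an open condition of full measure -/

/-- No bisector matches a discontinuity of the density and no two bisectors of a common point
coincide. -/
def IsRegularWeight (Ω : Set (Pt d)) (u : Pt d → ℝ) (p : Fin k → Pt d) (W : Fin k → ℝ) : Prop :=
  (∀ i j, i ≠ j → ¬ MatchesDiscontinuity Ω u (bisector p W i j)) ∧
  ∀ i j l, i ≠ j → i ≠ l → j ≠ l → bisector p W i j ≠ bisector p W i l

theorem IsRegularWeight.isRegularOffset {Ω : Set (Pt d)} {u : Pt d → ℝ} {p : Fin k → Pt d}
    {W : Fin k → ℝ} (h : IsRegularWeight Ω u p W) (i : Fin k) :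
    IsRegularOffset (Ω.indicator u) (fun j : {j // j ≠ i} => bisectorNormal p i j)
      (fun j => bisectorOffset p W i j) := by
  refine ⟨fun j => ?_, fun j l hl => ?_⟩
  · have := h.1 i j j.2.symm
    rw [MatchesDiscontinuity, not_not, bisector_eq] at this
    simpa [discontinuitySet] using this
  · have := h.2 i j l j.2.symm l.2.symm fun e => hl (Subtype.ext e.symm)
    rwa [bisector_eq, bisector_eq] at this

theorem eventually_bisector_ne_bisector {p : Fin k → Pt d} (hp : Injective p) {W : Fin k → ℝ}
    {i j l : Fin k} (hij : i ≠ j) (hil : i ≠ l) (h : bisector p W i j ≠ bisector p W i l) :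
    ∀ᶠ W' in 𝓝 W, bisector p W' i j ≠ bisector p W' i l := by
  have ha := bisectorNormal_ne_zero hp hij
  have hb := bisectorNormal_ne_zero hp hil
  simp only [ne_eq, bisector_eq, hyperplane_eq_iff ha hb] at h ⊢
  by_cases hr : ∃ r : ℝ, bisectorNormal p i l = r • bisectorNormal p i j
  · obtain ⟨r, hr⟩ := hr
    have h1 : bisectorOffset p W i l ≠ r * bisectorOffset p W i j := fun e => h ⟨r, hr, e⟩
    filter_upwards [((continuous_bisectorOffset p i l).continuousAt.ne_iff_eventually_ne
      ((continuous_bisectorOffset p i j).const_mul r).continuousAt).1 h1] with W' hW'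
    rintro ⟨r', hr', e⟩
    rw [hr] at hr'
    rw [smul_left_injective ℝ ha hr'] at hW'
    exact hW' e
  · exact Eventually.of_forall fun W' ⟨r, h1, _⟩ => hr ⟨r, h1⟩

variable {Ω : Set (Pt d)} {u : Pt d → ℝ} {p : Fin k → Pt d}

theorem isHyperplane_bisector (hp : Injective p) (W : Fin k → ℝ) {i j : Fin k} (h : i ≠ j) :
    IsHyperplane (bisector p W i j) :=
  ⟨_, bisectorNormal_ne_zero hp h, _, bisector_eq p W i j⟩

/-- With the normal fixed, distinct offsets give distinct hyperplanes. Only finitely many offsets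
are therefore bad, and a finite set is closed. -/
theorem eventually_not_matchesDiscontinuity
    (hfin : {H | IsHyperplane H ∧ MatchesDiscontinuity Ω u H}.Finite) (hp : Injective p)
    {W : Fin k → ℝ} {i j : Fin k} (hij : i ≠ j)
    (h : ¬ MatchesDiscontinuity Ω u (bisector p W i j)) :
    ∀ᶠ W' in 𝓝 W, ¬ MatchesDiscontinuity Ω u (bisector p W' i j) := by
  have h1 := hfin.preimage (hyperplane_injective (bisectorNormal_ne_zero hp hij)).injOn
  have h2 := (h1.isClosed.isOpen_compl.preimage (continuous_bisectorOffset p i j)).mem_nhds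
    (x := W) (fun hW => h (by rw [bisector_eq]; exact hW.2))
  filter_upwards [h2] with W' hW' hm
  refine hW' ?_
  have h3 := isHyperplane_bisector hp W' hij
  rw [bisector_eq] at h3 hm
  exact ⟨h3, hm⟩

theorem IsRegularWeight.eventually
    (hfin : {H | IsHyperplane H ∧ MatchesDiscontinuity Ω u H}.Finite) (hp : Injective p)
    {W : Fin k → ℝ} (h : IsRegularWeight Ω u p W) : ∀ᶠ W' in 𝓝 W, IsRegularWeight Ω u p W' := by
  refine Eventually.and ?_ ?_
  · simp only [eventually_all]
    exact fun i j hij => eventually_not_matchesDiscontinuity hfin hp hij (h.1 i j hij)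
  · simp only [eventually_all]
    exact fun i j l hij hil hjl =>
      eventually_bisector_ne_bisector hp hij hil (h.2 i j l hij hil hjl)

theorem ae_not_matchesDiscontinuity
    (hfin : {H | IsHyperplane H ∧ MatchesDiscontinuity Ω u H}.Finite) (hp : Injective p)
    {i j : Fin k} (hij : i ≠ j) :
    ∀ᵐ W : Fin k → ℝ, ¬ MatchesDiscontinuity Ω u (bisector p W i j) := by
  have h1 := hfin.preimage (hyperplane_injective (bisectorNormal_ne_zero hp hij)).injOn
  have h2 : ∀ᵐ W : Fin k → ℝ, ∀ t ∈ (fun t : ℝ => {x | inner ℝ (bisectorNormal p i j) x = t}) ⁻¹'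
      {H | IsHyperplane H ∧ MatchesDiscontinuity Ω u H}, bisectorOffset p W i j ≠ t := by
    rw [ae_ball_iff h1.countable]
    intro t _
    set φ : (Fin k → ℝ) →ₗ[ℝ] ℝ := (LinearMap.proj i : (Fin k → ℝ) →ₗ[ℝ] ℝ) - LinearMap.proj j
    have hφ : φ ≠ 0 := fun h0 => by
      have := LinearMap.congr_fun h0 (Pi.single i 1)
      simp [φ, hij.symm] at this
    rw [ae_iff]
    refine measure_mono_null (fun W hW => ?_)
      (addHaar_linearMap_eq volume hφ (t - (‖p j‖ ^ 2 - ‖p i‖ ^ 2)))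
    simp only [ne_eq, not_not, mem_ofPred_eq, bisectorOffset] at hW
    simp only [mem_ofPred_eq, φ, LinearMap.sub_apply, LinearMap.proj_apply]
    linarith
  filter_upwards [h2] with W hW hm
  have h3 := isHyperplane_bisector hp W hij
  rw [bisector_eq] at h3 hm
  exact hW _ ⟨h3, hm⟩ rfl

theorem ae_bisector_ne_bisector (hp : Injective p) {i j l : Fin k} (hij : i ≠ j) (hil : i ≠ l)
    (hjl : j ≠ l) : ∀ᵐ W : Fin k → ℝ, bisector p W i j ≠ bisector p W i l := by
  have ha := bisectorNormal_ne_zero hp hij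
  have hb := bisectorNormal_ne_zero hp hil
  simp only [ne_eq, bisector_eq, hyperplane_eq_iff ha hb]
  by_cases hr : ∃ r : ℝ, bisectorNormal p i l = r • bisectorNormal p i j
  · obtain ⟨r, hr⟩ := hr
    set φ : (Fin k → ℝ) →ₗ[ℝ] ℝ :=
      ((LinearMap.proj i : (Fin k → ℝ) →ₗ[ℝ] ℝ) - LinearMap.proj l) -
        r • ((LinearMap.proj i : (Fin k → ℝ) →ₗ[ℝ] ℝ) - LinearMap.proj j)
    -- The coefficient of `w_l` in `φ` is -1 whatever `r` is.
    have hφ : φ ≠ 0 := fun h0 => by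
      have := LinearMap.congr_fun h0 (Pi.single l 1)
      simp [φ, hil, hjl] at this
    rw [ae_iff]
    refine measure_mono_null (fun W hW => ?_) (addHaar_linearMap_eq volume hφ
      (r * (‖p j‖ ^ 2 - ‖p i‖ ^ 2) - (‖p l‖ ^ 2 - ‖p i‖ ^ 2)))
    simp only [not_not, mem_ofPred_eq] at hW
    obtain ⟨r', hr', e⟩ := hW
    rw [hr] at hr'
    rw [← smul_left_injective ℝ ha hr'] at e
    simp only [bisectorOffset] at e
    simp only [mem_ofPred_eq, φ, LinearMap.sub_apply, LinearMap.smul_apply, LinearMap.proj_apply,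
      smul_eq_mul]
    linarith
  · exact Eventually.of_forall fun W ⟨r, h1, _⟩ => hr ⟨r, h1⟩

theorem ae_isRegularWeight
    (hfin : {H | IsHyperplane H ∧ MatchesDiscontinuity Ω u H}.Finite) (hp : Injective p) :
    ∀ᵐ W : Fin k → ℝ, IsRegularWeight Ω u p W := by
  refine Eventually.and ?_ ?_
  · simp only [eventually_all]
    exact fun i j hij => ae_not_matchesDiscontinuity hfin hp hij
  · simp only [eventually_all]
    exact fun i j l hij hil hjl => ae_bisector_ne_bisector hp hij hil hjl

/-! ### Second-order smoothness of the objective -/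

theorem exists_bound_indicator (hu0 : ∀ x ∈ Ω, 0 ≤ u x) (hub : ∃ C : ℝ, ∀ x ∈ Ω, u x ≤ C) :
    ∃ C : ℝ, ∀ x, ‖Ω.indicator u x‖ ≤ C := by
  obtain ⟨C, hC⟩ := hub
  refine ⟨max C 0, fun x => ?_⟩
  by_cases hx : x ∈ Ω
  · rw [indicator_of_mem hx, Real.norm_of_nonneg (hu0 x hx)]
    exact (hC x hx).trans (le_max_left _ _)
  · simp [hx]

theorem exists_radius_indicator (hΩ : IsCompact Ω) (u : Pt d → ℝ) :
    ∃ R : ℝ, ∀ x, R < ‖x‖ → Ω.indicator u x = 0 := by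
  obtain ⟨R, hR⟩ := hΩ.isBounded.exists_norm_le
  exact ⟨R, fun x hx => indicator_of_notMem (fun h => hx.not_ge (hR x h)) u⟩

theorem eventually_isRegularOffset
    (hfin : {H | IsHyperplane H ∧ MatchesDiscontinuity Ω u H}.Finite) (hp : Injective p)
    {W : Fin k → ℝ} (h : IsRegularWeight Ω u p W) (i : Fin k) :
    ∀ᶠ c in 𝓝 fun j : {j // j ≠ i} => bisectorOffset p W i j,
      IsRegularOffset (Ω.indicator u) (fun j : {j // j ≠ i} => bisectorNormal p i j) c := by
  -- `σ` is a continuous right inverse of the map from weights to offsets, with `w_i` held fixed.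
  -- Every offset vector near that of `W` thus comes from weights near `W`, and openness of
  -- regularity carries over.
  set σ : ({j // j ≠ i} → ℝ) → Fin k → ℝ := fun c l =>
    if hl : l ≠ i then W i - (c ⟨l, hl⟩ - (‖p l‖ ^ 2 - ‖p i‖ ^ 2)) else W i with hσ
  have hσc : Continuous σ := by
    refine continuous_pi fun l => ?_
    by_cases hl : l ≠ i
    · simp only [hσ, hl, ne_eq, not_false_eq_true, dite_true]
      fun_prop
    · simp only [hσ, hl, dite_false]
      fun_prop
  have hσo : ∀ c, (fun j : {j // j ≠ i} => bisectorOffset p (σ c) i j) = c := by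
    intro c
    ext j
    simp [bisectorOffset, hσ, j.2]
  have hσW : σ (fun j : {j // j ≠ i} => bisectorOffset p W i j) = W := by
    ext l
    by_cases hl : l = i
    · subst hl
      simp [hσ]
    · simp [hσ, hl, bisectorOffset]
  have h1 := hσc.tendsto fun j : {j // j ≠ i} => bisectorOffset p W i j
  rw [hσW] at h1
  filter_upwards [h1.eventually (h.eventually hfin hp)] with c hc
  have := hc.isRegularOffset i
  rwa [hσo] at this

theorem contDiffAt_integral_powerCell (hΩ : IsCompact Ω) (hu : Measurable u)
    (hu0 : ∀ x ∈ Ω, 0 ≤ u x) (hub : ∃ C : ℝ, ∀ x ∈ Ω, u x ≤ C)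
    (hfin : {H | IsHyperplane H ∧ MatchesDiscontinuity Ω u H}.Finite) (hp : Injective p)
    {W : Fin k → ℝ} (h : IsRegularWeight Ω u p W) (i : Fin k) :
    ContDiffAt ℝ 1 (fun W => ∫ x in powerCell p W i, Ω.indicator u x) W := by
  obtain ⟨C, hC⟩ := exists_bound_indicator hu0 hub
  obtain ⟨R, hR⟩ := exists_radius_indicator hΩ u
  have h1 := contDiffAt_integral_polyhedron (hu.indicator hΩ.measurableSet) hC hR
    (fun j : {j // j ≠ i} => bisectorNormal_ne_zero hp j.2.symm)
    (eventually_isRegularOffset hfin hp h i)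
  have h2 : ContDiffAt ℝ 1 (fun W (j : {j // j ≠ i}) => bisectorOffset p W i j) W := by
    unfold bisectorOffset
    fun_prop
  simp only [powerCell_eq]
  exact h1.comp W h2

theorem objective_eq (hΩ : IsCompact Ω) (hu : Measurable u) (hu0 : ∀ x ∈ Ω, 0 ≤ u x)
    (W : Fin k → ℝ) : objective Ω u p W =
      ∑ i, ∫ x in powerCell p W i, Ω.indicator u x * (‖x - p i‖ ^ 2 - W i) :=
  Finset.sum_congr rfl fun i _ =>
    setIntegral_densityMeasure hΩ.measurableSet hu hu0 (measurableSet_powerCell p W i) _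

theorem dualObjective_zero (W : Fin k → ℝ) : dualObjective Ω u p 0 W = objective Ω u p W := by
  simp [dualObjective]

theorem integrable_indicator_density (hΩ : IsCompact Ω) (hu : Measurable u)
    (hu0 : ∀ x ∈ Ω, 0 ≤ u x) (hub : ∃ C : ℝ, ∀ x ∈ Ω, u x ≤ C) : Integrable (Ω.indicator u) := by
  obtain ⟨C, hC⟩ := exists_bound_indicator hu0 hub
  obtain ⟨R, hR⟩ := exists_radius_indicator hΩ u
  exact integrable_of_bounded_support (hu.indicator hΩ.measurableSet) hC hR

theorem dualObjective_le (hΩ : IsCompact Ω) (hu : Measurable u)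
    (hu0 : ∀ x ∈ Ω, 0 ≤ u x) (hub : ∃ C : ℝ, ∀ x ∈ Ω, u x ≤ C) (hp : Injective p) (ν : Fin k → ℝ)
    (W W' : Fin k → ℝ) : dualObjective Ω u p ν W ≤ dualObjective Ω u p ν W' +
      ∑ i, (ν i - ∫ x in powerCell p W' i, Ω.indicator u x) * (W i - W' i) := by
  have h1 := sum_integral_powerCell_le hΩ hp (integrable_indicator_density hΩ hu hu0 hub)
    (fun x hx => indicator_of_notMem hx u) (indicator_nonneg hu0) W W'
  rw [← objective_eq hΩ hu hu0, ← objective_eq hΩ hu hu0] at h1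
  have h2 : ∑ i, (ν i - ∫ x in powerCell p W' i, Ω.indicator u x) * (W i - W' i) =
      ∑ i, -(∫ x in powerCell p W' i, Ω.indicator u x) * (W i - W' i) +
        (∑ i, ν i * W i - ∑ i, ν i * W' i) := by
    rw [← Finset.sum_sub_distrib, ← Finset.sum_add_distrib]
    exact Finset.sum_congr rfl fun i _ => by ring
  rw [h2, dualObjective, dualObjective]
  linarith

theorem contDiffAt_dualObjective (hΩ : IsCompact Ω) (hu : Measurable u)
    (hu0 : ∀ x ∈ Ω, 0 ≤ u x) (hub : ∃ C : ℝ, ∀ x ∈ Ω, u x ≤ C)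
    (hfin : {H | IsHyperplane H ∧ MatchesDiscontinuity Ω u H}.Finite) (hp : Injective p)
    (ν : Fin k → ℝ) {W : Fin k → ℝ} (h : IsRegularWeight Ω u p W) :
    ContDiffAt ℝ 2 (dualObjective Ω u p ν) W := by
  have hint := integrable_indicator_density hΩ hu hu0 hub
  rw [show (2 : WithTop ℕ∞) = ((1 : ℕ) : WithTop ℕ∞) + 1 by norm_num,
    contDiffAt_succ_iff_hasFDerivAt]
  refine ⟨fun W => ∑ i, (ν i - ∫ x in powerCell p W i, Ω.indicator u x) •
    (ContinuousLinearMap.proj i : (Fin k → ℝ) →L[ℝ] ℝ), ⟨univ, univ_mem, fun W _ =>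
      hasFDerivAt_of_supergradient (dualObjective_le hΩ hu hu0 hub hp ν) fun i => ?_⟩, ?_⟩
  · exact (continuous_const.sub (continuous_integral_powerCell hp hint i)).continuousAt
  · refine ContDiffAt.sum fun i _ => ?_
    have h1 := contDiffAt_integral_powerCell hΩ hu hu0 hub hfin hp h i
    exact ((contDiffAt_const (c := ν i)).sub h1).smul
      (contDiffAt_const (c := (ContinuousLinearMap.proj i : (Fin k → ℝ) →L[ℝ] ℝ)))

end PowerDiagram

end SemiDiscreteOT

theorem mainTheorem4 {d k : ℕ} (Ω : Set (SemiDiscreteOT.Pt d)) (hΩ : IsCompact Ω)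
    (u : SemiDiscreteOT.Pt d → ℝ) (hu_meas : Measurable u)
    (hu_nonneg : ∀ x ∈ Ω, 0 ≤ u x) (hu_bdd : ∃ C : ℝ, ∀ x ∈ Ω, u x ≤ C)
    (hu_disc : {H : Set (SemiDiscreteOT.Pt d) |
      SemiDiscreteOT.IsHyperplane H ∧ SemiDiscreteOT.MatchesDiscontinuity Ω u H}.Finite)
    (p : Fin k → SemiDiscreteOT.Pt d) (hp : Function.Injective p) (ν : Fin k → ℝ) :
    (∀ᵐ W : Fin k → ℝ, ContDiffAt ℝ 2 (SemiDiscreteOT.objective Ω u p) W ∧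
      ContDiffAt ℝ 2 (SemiDiscreteOT.dualObjective Ω u p ν) W) ∧
    (∀ W : Fin k → ℝ,
      (∀ i j, i ≠ j →
        ¬ SemiDiscreteOT.MatchesDiscontinuity Ω u (SemiDiscreteOT.bisector p W i j)) →
      (∀ i j l, i ≠ j → i ≠ l → j ≠ l →
        SemiDiscreteOT.bisector p W i j ≠ SemiDiscreteOT.bisector p W i l) →
      ContDiffAt ℝ 2 (SemiDiscreteOT.objective Ω u p) W ∧
        ContDiffAt ℝ 2 (SemiDiscreteOT.dualObjective Ω u p ν) W) ∧
    ConcaveOn ℝ Set.univ (SemiDiscreteOT.dualObjective Ω u p ν) ∧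
    (∀ W : Fin k → ℝ,
      IsMaxOn (SemiDiscreteOT.dualObjective Ω u p ν) Set.univ W ↔
        ∀ i, (SemiDiscreteOT.densityMeasure Ω u).real (SemiDiscreteOT.powerCell p W i) = ν i) := by
  have hreg : ∀ W, SemiDiscreteOT.IsRegularWeight Ω u p W →
      ContDiffAt ℝ 2 (SemiDiscreteOT.objective Ω u p) W ∧
        ContDiffAt ℝ 2 (SemiDiscreteOT.dualObjective Ω u p ν) W := by
    intro W h
    refine ⟨?_, SemiDiscreteOT.contDiffAt_dualObjective hΩ hu_meas hu_nonneg hu_bdd hu_disc hp ν h⟩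
    -- The objective is the case ν = 0 of the dual objective.
    rw [← funext (SemiDiscreteOT.dualObjective_zero (Ω := Ω) (u := u) (p := p))]
    exact SemiDiscreteOT.contDiffAt_dualObjective hΩ hu_meas hu_nonneg hu_bdd hu_disc hp 0 h
  have hsup := SemiDiscreteOT.dualObjective_le hΩ hu_meas hu_nonneg hu_bdd hp ν
  refine ⟨?_, fun W h1 h2 => hreg W ⟨h1, h2⟩, SemiDiscreteOT.concaveOn_of_supergradient hsup,
    fun W => ?_⟩
  · filter_upwards [SemiDiscreteOT.ae_isRegularWeight hu_disc hp] with W hW using hreg W hW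
  · rw [SemiDiscreteOT.isMaxOn_iff_of_supergradient hsup fun i => (continuous_const.sub
      (SemiDiscreteOT.continuous_integral_powerCell hp
        (SemiDiscreteOT.integrable_indicator_density hΩ hu_meas hu_nonneg hu_bdd) i)).continuousAt]
    refine forall_congr' fun i => ?_
    rw [SemiDiscreteOT.densityMeasure_real hΩ.measurableSet hu_meas hu_nonneg
      (SemiDiscreteOT.measurableSet_powerCell p W i), sub_eq_zero, eq_comm]
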